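/- **Correlated stochastic orienteering.** An instance with budget $B\in\mathbb{N}$ consists of a finite vertex set $V$ with a root $\rho\in V$; symmetric integer travel times $d:V\times V\to\{0,1,\dots,B\}$ with $d(v,v)=0$ that satisfy the triangle inequality (distinct vertices may have distance $0$); and, at each vertex $v$, a job with a random size $S_v\in\{0,1,\dots,B\}$ with $\Pr[S_v=s]=\pi_v(s)$ and reward $r_v(S_v)$, where $r_v:\{0,1,\dots,B\}\to[0,\infty)$. The sizes are independent across vertices. A policy starts at $\rho$ at time $0$ and runs jobs one after the other, each job at most once; travelling from $u$ to $v$ takes time $d(u,v)$, and running the job at $v$ takes time $S_v$, which becomes known when the job is completed. The reward $r_v(S_v)$ is collected if the job at $v$ is completed at or before time $B$. An *adaptive* policy is a decision tree: the choice of the next job may depend on the sizes of the jobs run so far. A *non-adaptive* policy is a fixed sequence of distinct vertices. Let $\mathsf{Opt}_{\mathrm{ad}}(I)$ and $\mathsf{Opt}_{\mathrm{na}}(I)$ be the suprema of the expected total reward over all adaptive and over all non-adaptive policies of the instance $I$. The *adaptivity gap* for budget $B$ is $\sup_I \mathsf{Opt}_{\mathrm{ad}}(I)/\mathsf{Opt}_{\mathrm{na}}(I)$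 over all instances $I$ with budget $B$ (with $a/0=\infty$ for $a>0$, and $0/0=0$). **Theorem.** The adaptivity gap of correlated stochastic orienteering is $O(\log\log B)$: there is an absolute constant $C>0$ such that for every integer $B\ge 3$ the adaptivity gap for budget $B$ is at most $C\log\log B$. -/

import Mathlib

open scoped NNReal ENNReal

universe u

/-- An instance of correlated stochastic orienteering on the vertex set `V` with budget `B`.
All travel times and job sizes are integers in `{0, …, B}`; distinct vertices may be at
distance `0`.  The job at `v` has size `s` with probability `sizeDist v s`, and then its
reward is `reward v s`, so that reward and size are correlated. -/
structure CorrOrient (V : Type u) (B : ℕ) where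
  root : V
  dist : V → V → ℕ
  dist_self : ∀ v, dist v v = 0
  dist_symm : ∀ v w, dist v w = dist w v
  dist_triangle : ∀ v w x, dist v x ≤ dist v w + dist w x
  dist_le : ∀ v w, dist v w ≤ B
  sizeDist : V → PMF (Fin (B + 1))
  reward : V → Fin (B + 1) → ℝ≥0

/-- Decision trees: at `node v next` the solution travels to `v`, runs the job there to
completion, observes its size `s`, and goes on with `next s`; at `leaf` it ends. -/
inductive DecisionTree (V : Type u) (B : ℕ) : Type u
  | leaf : DecisionTree V B
  | node (v : V) (next : Fin (B + 1) → DecisionTree V B) : DecisionTree V B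

/-- No vertex of `visited` labels a node of the tree, and no vertex labels two nodes of the
same root-leaf path. -/
def DecisionTree.VisitsOnce {V : Type u} {B : ℕ} : DecisionTree V B → Set V → Prop
  | .leaf, _ => True
  | .node v next, visited => v ∉ visited ∧ ∀ s, (next s).VisitsOnce (insert v visited)

/-- Adaptive policies: decision trees that run each job at most once. -/
def AdaptivePolicy (V : Type u) (B : ℕ) : Type u :=
  {T : DecisionTree V B // T.VisitsOnce ∅}

/-- Non-adaptive policies: the list of the vertices whose jobs are run, in this order.
The path starts at the root; the job at the root is run only if the root is listed. -/
def NonAdaptivePolicy (V : Type u) : Type u :=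
  {P : List V // P.Nodup}

namespace CorrOrient

variable {V : Type u} {B : ℕ} (I : CorrOrient V B)

/-- Total reward that the decision tree `T` collects from position `x` and time `t` on, if
each job `v` has size `ω v`.  A job yields its reward if it is completed by time `B`. -/
def treeReward (ω : V → Fin (B + 1)) : DecisionTree V B → V → ℕ → ℝ≥0
  | .leaf, _, _ => 0
  | .node v next, x, t =>
      (if t + I.dist x v + (ω v : ℕ) ≤ B then I.reward v (ω v) else 0)
        + treeReward ω (next (ω v)) v (t + I.dist x v + (ω v : ℕ))

/-- Total reward that is collected from position `x` and time `t` on by running the jobs of a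
fixed list of vertices in order, if each job `v` has size `ω v`. -/
def pathReward (ω : V → Fin (B + 1)) : List V → V → ℕ → ℝ≥0
  | [], _, _ => 0
  | v :: P, x, t =>
      (if t + I.dist x v + (ω v : ℕ) ≤ B then I.reward v (ω v) else 0)
        + pathReward ω P v (t + I.dist x v + (ω v : ℕ))

open Classical in
/-- Expectation of `f`, where the sizes of the jobs are independent and the size of job `v`
has the law `I.sizeDist v`. -/
noncomputable def expect [Fintype V] (f : (V → Fin (B + 1)) → ℝ≥0) : ℝ≥0∞ :=
  ∑ ω : V → Fin (B + 1), (∏ v, I.sizeDist v (ω v)) * (f ω : ℝ≥0∞)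

/-- Expected reward of an adaptive policy, which starts at the root at time `0`. -/
noncomputable def adaptiveValue [Fintype V] (T : AdaptivePolicy V B) : ℝ≥0∞ :=
  I.expect fun ω => I.treeReward ω T.1 I.root 0

/-- Expected reward of a non-adaptive policy, which starts at the root at time `0`. -/
noncomputable def nonAdaptiveValue [Fintype V] (P : NonAdaptivePolicy V) : ℝ≥0∞ :=
  I.expect fun ω => I.pathReward ω P.1 I.root 0

/-- The optimal expected reward of an adaptive policy. -/
noncomputable def optAdaptive [Fintype V] : ℝ≥0∞ :=
  ⨆ T : AdaptivePolicy V B, I.adaptiveValue T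

/-- The optimal expected reward of a non-adaptive policy. -/
noncomputable def optNonAdaptive [Fintype V] : ℝ≥0∞ :=
  ⨆ P : NonAdaptivePolicy V, I.nonAdaptiveValue P

end CorrOrient

/-- The adaptivity gap for budget `B`: the supremum over all instances with budget `B`, on all
finite vertex sets, of the ratio of the adaptive to the non-adaptive optimum.  Both optima are
finite; a positive number over `0` is `∞`, and instances with `0 / 0`, where no policy has a
positive expected reward, contribute `0`. -/
noncomputable def adaptivityGap (B : ℕ) : ℝ≥0∞ :=
  ⨆ (V : Type u) (_ : Fintype V) (I : CorrOrient V B), I.optAdaptive / I.optNonAdaptive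

/-!
The proof cuts an adaptive policy down to a single root-leaf path, and then runs a random sparse
part of that path as a non-adaptive policy.

*Balanced runs.* For a scale `2 ^ j` truncate all sizes at `2 ^ j`. While the total size `e` of
the jobs run so far satisfies `e + 1 < 2 ^ (j + 1)`, the sum of their truncated means is unlikely
to exceed `M * 2 ^ j`: the exponential `exp (mean / (2 * 2 ^ j) - size / 2 ^ j)` is a
supermartingale, so the probability is at most `exp (2 - M / 2)`. There are about `log B` scales,
hence for some `M` of order `log log B` the probability that this happens at any scale is at most
`1 / 2`. Cutting the policy where it happens for the first time costs at most half of the adaptive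
optimum, as what is left of the policy is worth at most the optimum itself. The cut policy has a
root-leaf path, with a recorded size for each job, whose jobs started at their recorded times have
a total expected reward of at least the value of the cut policy (`exists_balanced_run`).

*Thinning.* Keep each job of this path independently with probability `p = 1 / (2 * M)`. For a job
recorded to start at total size `e`, with `2 ^ j ≤ e + 1 < 2 ^ (j + 1)`, the kept jobs before it
have a mean total truncated size of at most `p * M * 2 ^ j = 2 ^ j / 2`. By Markov's inequality
their total size is below `2 ^ j`, hence at most `e`, with probability at least `1 / 2`; and then
the job starts no later than recorded, since skipping vertices does not lengthen the travel. So
some sublist of the path is worth at least the fraction `p / 2` of the path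
(`runValue_le_thinnedMean`).

Both steps are inductions over the tree or the path on linear inequalities between real numbers.
The independence of the sizes enters only in `finsum_weight_mul_treeReward`, which turns
expectations over the product space into the recursion `treeValue`.
-/

/-! ### Decision trees and random sublists -/

namespace DecisionTree

variable {V : Type u} {B : ℕ}

theorem VisitsOnce.anti {T : DecisionTree V B} {S S' : Set V} (h : S' ⊆ S)
    (hT : T.VisitsOnce S) : T.VisitsOnce S' := by
  induction T generalizing S S' with
  | leaf => trivial
  | node v next ih =>
    exact ⟨fun hv => hT.1 (h hv), fun s => ih s (Set.insert_subset_insert h) (hT.2 s)⟩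

/-- A fixed sequence of jobs, as the decision tree that ignores the observed sizes. -/
def ofList : List V → DecisionTree V B
  | [] => .leaf
  | v :: P => .node v fun _ => ofList P

theorem visitsOnce_ofList {P : List V} {S : Set V} (hP : P.Nodup) (hS : ∀ v ∈ P, v ∉ S) :
    (ofList P : DecisionTree V B).VisitsOnce S := by
  induction P generalizing S with
  | nil => trivial
  | cons v P ih =>
    rw [List.nodup_cons] at hP
    refine ⟨hS v (by simp), fun _ => ih hP.2 fun w hw => ?_⟩
    rintro (rfl | h)
    · exact hP.1 hw
    · exact hS w (by simp [hw]) h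

end DecisionTree

/-- The mean of `F` over a random sublist of a list, which keeps each entry independently with
probability `p`. -/
noncomputable def thinnedMean {V : Type u} (p : ℝ) : List V → (List V → ℝ) → ℝ
  | [], F => F []
  | v :: P, F => (1 - p) * thinnedMean p P F + p * thinnedMean p P fun Q => F (v :: Q)

section Thinning

variable {V : Type u}

theorem thinnedMean_affine {ι : Type*} (p c : ℝ) (s : Finset ι) (a : ι → ℝ)
    (F : ι → List V → ℝ) (P : List V) :
    thinnedMean p P (fun Q => c + ∑ i ∈ s, a i * F i Q)
      = c + ∑ i ∈ s, a i * thinnedMean p P (F i) := by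
  induction P generalizing F with
  | nil => rfl
  | cons v P ih =>
    simp only [thinnedMean]
    rw [ih F, ih fun i Q => F i (v :: Q)]
    simp only [mul_add, Finset.sum_add_distrib, Finset.mul_sum]
    simp only [mul_left_comm (a _)]
    ring

theorem exists_sublist_thinnedMean_le {p : ℝ} (h0 : 0 ≤ p) (h1 : p ≤ 1) (P : List V)
    (F : List V → ℝ) : ∃ Q : List V, Q.Sublist P ∧ thinnedMean p P F ≤ F Q := by
  induction P generalizing F with
  | nil => exact ⟨[], List.Sublist.refl _, le_rfl⟩
  | cons v P ih =>
    obtain ⟨Q₁, hQ₁, h₁⟩ := ih F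
    obtain ⟨Q₂, hQ₂, h₂⟩ := ih fun Q => F (v :: Q)
    have hle : thinnedMean p (v :: P) F ≤ (1 - p) * F Q₁ + p * F (v :: Q₂) := by
      simp only [thinnedMean]
      gcongr
    rcases le_total (F Q₁) (F (v :: Q₂)) with h | h
    · exact ⟨v :: Q₂, hQ₂.cons_cons v, by nlinarith⟩
    · exact ⟨Q₁, hQ₁.cons v, by nlinarith⟩

end Thinning

namespace CorrOrient

variable {V : Type u} {B : ℕ} (I : CorrOrient V B)

/-! ### The value of a decision tree -/

/-- The probability, as a real number, that the job at `v` has size `s`. -/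
noncomputable def prob (v : V) (s : Fin (B + 1)) : ℝ := (I.sizeDist v s).toReal

theorem prob_nonneg (v : V) (s : Fin (B + 1)) : 0 ≤ I.prob v s := ENNReal.toReal_nonneg

theorem sum_prob (v : V) : ∑ s, I.prob v s = 1 := by
  unfold prob
  rw [← ENNReal.toReal_sum fun s _ => (I.sizeDist v).apply_ne_top s, ← tsum_fintype (L := .unconditional _),
    (I.sizeDist v).tsum_coe, ENNReal.toReal_one]

/-- Expected reward of the job at `v` if it is started at time `τ`. -/
noncomputable def jobValue (v : V) (τ : ℕ) : ℝ :=
  ∑ s : Fin (B + 1), I.prob v s * (if τ + (s : ℕ) ≤ B then (I.reward v s : ℝ) else 0)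

/-- Expected reward of the decision tree `T` from position `x` and time `t` on, by recursion
over the tree: the size of the job at each node is drawn afresh. -/
noncomputable def treeValue : DecisionTree V B → V → ℕ → ℝ
  | .leaf, _, _ => 0
  | .node v next, x, t => I.jobValue v (t + I.dist x v)
      + ∑ s, I.prob v s * treeValue (next s) v (t + I.dist x v + (s : ℕ))

theorem jobValue_nonneg (v : V) (τ : ℕ) : 0 ≤ I.jobValue v τ :=
  Finset.sum_nonneg fun s _ => mul_nonneg (I.prob_nonneg v s) (by positivity)

theorem jobValue_anti (v : V) : Antitone (I.jobValue v) := by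
  intro τ σ h
  refine Finset.sum_le_sum fun s _ => mul_le_mul_of_nonneg_left ?_ (I.prob_nonneg v s)
  split_ifs
  · exact le_rfl
  · omega
  · positivity
  · exact le_rfl

theorem jobValue_eq_zero {v : V} {τ : ℕ} (h : B < τ) : I.jobValue v τ = 0 :=
  Finset.sum_eq_zero fun s _ => by rw [if_neg (by omega), mul_zero]

theorem treeValue_eq_zero (T : DecisionTree V B) {x : V} {t : ℕ} (h : B < t) :
    I.treeValue T x t = 0 := by
  induction T generalizing x t with
  | leaf => rfl
  | node v next ih =>
    simp only [treeValue]
    rw [I.jobValue_eq_zero (by omega), zero_add]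
    exact Finset.sum_eq_zero fun s _ => by rw [ih s (by omega), mul_zero]

/-- A decision tree is worth at least as much from a position `y` and time `u` from which every
vertex is reached no later. -/
theorem treeValue_mono (T : DecisionTree V B) {x y : V} {t u : ℕ}
    (h : ∀ w, u + I.dist y w ≤ t + I.dist x w) : I.treeValue T x t ≤ I.treeValue T y u := by
  induction T generalizing x y t u with
  | leaf => exact le_rfl
  | node v next ih =>
    simp only [treeValue]
    gcongr with s
    · exact I.jobValue_anti v (h v)
    · exact I.prob_nonneg v s
    · exact ih s fun w => by have := h v; omega

/-! ### Expected rewards over the product space of sizes -/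

open Classical in
theorem treeReward_update {T : DecisionTree V B} {S : Set V} (hT : T.VisitsOnce S) {v : V}
    (hv : v ∈ S) (ω : V → Fin (B + 1)) (s : Fin (B + 1)) (x : V) (t : ℕ) :
    I.treeReward (Function.update ω v s) T x t = I.treeReward ω T x t := by
  induction T generalizing S x t with
  | leaf => rfl
  | node w next ih =>
    have hne : w ≠ v := fun h => hT.1 (h ▸ hv)
    simp only [treeReward, Function.update_of_ne hne]
    rw [ih _ (hT.2 _) (Set.mem_insert_of_mem w hv)]

theorem pathReward_eq (ω : V → Fin (B + 1)) (P : List V) (x : V) (t : ℕ) :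
    I.pathReward ω P x t = I.treeReward ω (.ofList P) x t := by
  induction P generalizing x t with
  | nil => rfl
  | cons v P ih => simp only [pathReward, DecisionTree.ofList, treeReward, ih]

section Expectation

variable [Fintype V]

/-- The probability of the size vector `ω`. -/
noncomputable def weight (ω : V → Fin (B + 1)) : ℝ := ∏ v, I.prob v (ω v)

theorem weight_nonneg (ω : V → Fin (B + 1)) : 0 ≤ I.weight ω :=
  Finset.prod_nonneg fun v _ => I.prob_nonneg v _

theorem sum_weight : ∑ᶠ ω : V → Fin (B + 1), I.weight ω = 1 := by
  classical
  rw [finsum_eq_sum_of_fintype]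
  unfold weight
  have := Finset.prod_univ_sum (fun _ : V => (Finset.univ : Finset (Fin (B + 1))))
    (fun v s => I.prob v s)
  simp only [I.sum_prob, Finset.prod_const_one, Fintype.piFinset_univ] at this
  exact this.symm

theorem expect_eq (f : (V → Fin (B + 1)) → ℝ≥0) :
    I.expect f = ENNReal.ofReal (∑ᶠ ω, I.weight ω * f ω) := by
  classical
  rw [finsum_eq_sum_of_fintype]
  unfold expect
  rw [ENNReal.ofReal_sum_of_nonneg
    fun ω _ => mul_nonneg (I.weight_nonneg ω) (f ω).coe_nonneg]
  have hw : ∀ ω, (∏ v, I.sizeDist v (ω v)) * (f ω : ℝ≥0∞)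
      = ENNReal.ofReal (I.weight ω * f ω) := fun ω => by
    rw [ENNReal.ofReal_mul (I.weight_nonneg ω), ENNReal.ofReal_coe_nnreal]
    unfold weight prob
    rw [ENNReal.ofReal_prod_of_nonneg fun _ _ => ENNReal.toReal_nonneg]
    congr 1
    exact Finset.prod_congr rfl fun v _ =>
      (ENNReal.ofReal_toReal ((I.sizeDist v).apply_ne_top _)).symm
  convert Finset.sum_congr rfl fun ω _ => hw ω

open Classical in
/-- Independence: if `F s` does not depend on the size of the job at `v`, then in the mean of
`F (ω v) ω` the two occurrences of `ω` may be drawn separately. -/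
theorem sum_weight_mul_eq (v : V) (F : Fin (B + 1) → (V → Fin (B + 1)) → ℝ)
    (hF : ∀ s ω s', F s (Function.update ω v s') = F s ω) :
    ∑ ω, I.weight ω * F (ω v) ω = ∑ s, I.prob v s * ∑ ω, I.weight ω * F s ω := by
  -- Exchanging `s` with the coordinate `ω v` preserves the product measure.
  let E : (V → Fin (B + 1)) × Fin (B + 1) ≃ (V → Fin (B + 1)) × Fin (B + 1) :=
    { toFun := fun q => (Function.update q.1 v q.2, q.1 v)
      invFun := fun q => (Function.update q.1 v q.2, q.1 v)
      left_inv := fun q => by simp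
      right_inv := fun q => by simp }
  have hw : ∀ ω s, I.weight (Function.update ω v s) * I.prob v (ω v)
      = I.weight ω * I.prob v s := fun ω s => by
    unfold weight
    rw [← Finset.mul_prod_erase _ _ (Finset.mem_univ v),
      ← Finset.mul_prod_erase _ (fun w => I.prob w (ω w)) (Finset.mem_univ v),
      Function.update_self, Finset.prod_congr rfl fun w hw => by
        rw [Function.update_of_ne (Finset.ne_of_mem_erase hw)]]
    ring
  calc ∑ ω, I.weight ω * F (ω v) ω
      = ∑ q : (V → Fin (B + 1)) × Fin (B + 1),
          I.weight q.1 * I.prob v q.2 * F (q.1 v) q.1 := by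
        rw [Fintype.sum_prod_type]
        refine Finset.sum_congr rfl fun ω _ => ?_
        simp only [mul_right_comm _ (I.prob v _), ← Finset.mul_sum, I.sum_prob, mul_one]
    _ = ∑ q : (V → Fin (B + 1)) × Fin (B + 1), I.weight q.1 * I.prob v q.2 * F q.2 q.1 := by
        rw [← E.sum_comp]
        refine Finset.sum_congr rfl fun q _ => ?_
        simp only [E, Equiv.coe_fn_mk, hw, Function.update_self, hF]
    _ = ∑ s, I.prob v s * ∑ ω, I.weight ω * F s ω := by
        rw [Fintype.sum_prod_type_right]
        refine Finset.sum_congr rfl fun s _ => ?_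
        rw [Finset.mul_sum]
        exact Finset.sum_congr rfl fun ω _ => by ring

theorem finsum_weight_mul_treeReward {T : DecisionTree V B} {S : Set V} (hT : T.VisitsOnce S)
    (x : V) (t : ℕ) : ∑ᶠ ω, I.weight ω * I.treeReward ω T x t = I.treeValue T x t := by
  classical
  induction T generalizing S x t with
  | leaf => simp [treeReward, treeValue]
  | node v next ih =>
    have key := I.sum_weight_mul_eq v (fun s ω =>
      (if t + I.dist x v + (s : ℕ) ≤ B then (I.reward v s : ℝ) else 0)
        + I.treeReward ω (next s) v (t + I.dist x v + (s : ℕ))) fun s ω s' => by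
          rw [I.treeReward_update (hT.2 s) (Set.mem_insert v S)]
    have h1 := I.sum_weight
    rw [finsum_eq_sum_of_fintype] at h1 ⊢
    have ih' := fun s => ih s (hT.2 s) v (t + I.dist x v + (s : ℕ))
    simp only [finsum_eq_sum_of_fintype] at ih'
    simp only [treeValue, jobValue, treeReward, ← Finset.sum_add_distrib, ← mul_add]
    simp only [NNReal.coe_add, apply_ite NNReal.toReal, NNReal.coe_zero]
    rw [key]
    refine Finset.sum_congr rfl fun s _ => ?_
    rw [← ih' s]
    simp only [mul_add, Finset.sum_add_distrib, ← Finset.sum_mul, h1, one_mul]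

theorem expect_treeReward {T : DecisionTree V B} (hT : T.VisitsOnce ∅) :
    I.expect (fun ω => I.treeReward ω T I.root 0) = ENNReal.ofReal (I.treeValue T I.root 0) := by
  rw [expect_eq, I.finsum_weight_mul_treeReward hT]

theorem nonAdaptiveValue_eq (P : NonAdaptivePolicy V) :
    I.nonAdaptiveValue P = ENNReal.ofReal (I.treeValue (.ofList P.1) I.root 0) := by
  unfold nonAdaptiveValue
  simp only [pathReward_eq]
  exact I.expect_treeReward (DecisionTree.visitsOnce_ofList P.2 fun _ _ => id)

theorem adaptiveValue_eq (T : AdaptivePolicy V B) :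
    I.adaptiveValue T = ENNReal.ofReal (I.treeValue T.1 I.root 0) :=
  I.expect_treeReward T.2

open Classical in
theorem treeReward_le {T : DecisionTree V B} {S : Set V} (hT : T.VisitsOnce S)
    (ω : V → Fin (B + 1)) (x : V) (t : ℕ) :
    I.treeReward ω T x t ≤ ∑ v with v ∉ S, I.reward v (ω v) := by
  induction T generalizing S x t with
  | leaf => exact zero_le
  | node v next ih =>
    rw [← Finset.add_sum_erase _ _ (a := v) (by simpa using hT.1)]
    refine add_le_add (by split_ifs <;> simp) ((ih _ (hT.2 _) _ _).trans_eq ?_)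
    congr 1
    ext w
    simp

theorem optAdaptive_ne_top : I.optAdaptive ≠ ⊤ := by
  classical
  refine ne_top_of_le_ne_top (b := I.expect fun ω => ∑ v, I.reward v (ω v)) ?_
    (iSup_le fun T => ?_)
  · rw [expect_eq]
    exact ENNReal.ofReal_ne_top
  · unfold adaptiveValue expect
    gcongr with ω
    refine (I.treeReward_le T.2 ω _ _).trans_eq ?_
    simp

end Expectation

/-! ### Truncated means and the exponential potential -/

/-- The mean of the size of the job at `v`, truncated at `2 ^ j`. -/
noncomputable def truncMean (v : V) (j : ℕ) : ℝ :=
  ∑ s : Fin (B + 1), I.prob v s * min (s : ℝ) (2 ^ j)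

theorem exp_neg_le_one_sub_half {x : ℝ} (h0 : 0 ≤ x) (h1 : x ≤ 1) :
    Real.exp (-x) ≤ 1 - x / 2 := by
  have h := Real.add_one_le_exp x
  rw [Real.exp_neg]
  refine (inv_anti₀ (by linarith) h).trans ?_
  rw [inv_le_iff_one_le_mul₀ (by linarith)]
  nlinarith

/-- One step of the potential: after truncation, `s / 2 ^ j` lies in `[0, 1]`, where
`exp (-x) ≤ 1 - x / 2`. -/
theorem sum_prob_mul_exp_le (v : V) (j : ℕ) :
    ∑ s : Fin (B + 1), I.prob v s * Real.exp (-((s : ℕ) : ℝ) / 2 ^ j)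
      ≤ Real.exp (-(I.truncMean v j / (2 * 2 ^ j))) := by
  have h2 : (0 : ℝ) < 2 ^ j := by positivity
  calc ∑ s : Fin (B + 1), I.prob v s * Real.exp (-((s : ℕ) : ℝ) / 2 ^ j)
      ≤ ∑ s : Fin (B + 1), I.prob v s * (1 - min ((s : ℕ) : ℝ) (2 ^ j) / 2 ^ j / 2) := by
        gcongr with s
        · exact I.prob_nonneg v s
        · refine le_trans (Real.exp_le_exp.2 ?_) (exp_neg_le_one_sub_half (by positivity)
            ((div_le_one h2).2 (min_le_right _ _)))
          rw [neg_div]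
          gcongr
          exact min_le_left _ _
    _ = 1 - I.truncMean v j / (2 * 2 ^ j) := by
        simp only [mul_sub, mul_one, Finset.sum_sub_distrib, I.sum_prob, truncMean,
          Finset.sum_div]
        congr 1
        exact Finset.sum_congr rfl fun s _ => by field_simp
    _ ≤ _ := Real.one_sub_le_exp_neg _

/-- The exponential potential of a run of total size `e` whose jobs have total mean `m j` when
truncated at `2 ^ j`. It is at least `1` when `m j > M * 2 ^ j` at the scale `2 ^ j` of `e`,
and it does not increase in expectation when a further job is run. -/
noncomputable def potential (B : ℕ) (M : ℝ) (m : ℕ → ℝ) (e : ℕ) : ℝ :=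
  ∑ j ∈ Finset.range (Nat.log 2 (B + 1) + 1),
    Real.exp (m j / (2 * 2 ^ j) + -(e : ℝ) / 2 ^ j + (2 - M / 2))

theorem potential_nonneg (B : ℕ) (M : ℝ) (m : ℕ → ℝ) (e : ℕ) : 0 ≤ potential B M m e :=
  Finset.sum_nonneg fun _ _ => (Real.exp_pos _).le

theorem one_le_potential {M : ℝ} {m : ℕ → ℝ} {e : ℕ} (he : e ≤ B)
    (h : M * 2 ^ Nat.log 2 (e + 1) < m (Nat.log 2 (e + 1))) : 1 ≤ potential B M m e := by
  set j := Nat.log 2 (e + 1) with hj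
  have hmem : j ∈ Finset.range (Nat.log 2 (B + 1) + 1) := by
    rw [Finset.mem_range, Nat.lt_succ_iff]
    exact Nat.log_mono_right (by omega)
  have h2 : (0 : ℝ) < 2 ^ j := by positivity
  have hlt : (e : ℝ) + 1 < 2 ^ (j + 1) := by
    exact_mod_cast Nat.lt_pow_succ_log_self one_lt_two (e + 1)
  refine le_trans ?_ (Finset.single_le_sum (f := fun j =>
    Real.exp (m j / (2 * 2 ^ j) + -(e : ℝ) / 2 ^ j + (2 - M / 2)))
    (fun _ _ => (Real.exp_pos _).le) hmem)
  rw [Real.one_le_exp_iff]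
  have h3 : M / 2 ≤ m j / (2 * 2 ^ j) := by
    rw [le_div_iff₀ (by positivity)]
    nlinarith
  have h4 : -2 ≤ -(e : ℝ) / 2 ^ j := by
    rw [le_div_iff₀ h2]
    rw [pow_succ] at hlt
    linarith
  linarith

theorem sum_prob_mul_potential_le (v : V) (M : ℝ) (m : ℕ → ℝ) (e : ℕ) :
    ∑ s : Fin (B + 1), I.prob v s * potential B M (fun j => m j + I.truncMean v j) (e + s)
      ≤ potential B M m e := by
  unfold potential
  simp only [Finset.mul_sum]
  rw [Finset.sum_comm]
  refine Finset.sum_le_sum fun j _ => ?_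
  have hsplit : ∀ s : Fin (B + 1),
      I.prob v s * Real.exp ((m j + I.truncMean v j) / (2 * 2 ^ j)
        + -((e + (s : ℕ) : ℕ) : ℝ) / 2 ^ j + (2 - M / 2))
      = Real.exp (m j / (2 * 2 ^ j) + -(e : ℝ) / 2 ^ j + (2 - M / 2)
          + I.truncMean v j / (2 * 2 ^ j))
        * (I.prob v s * Real.exp (-((s : ℕ) : ℝ) / 2 ^ j)) := fun s => by
    rw [mul_left_comm, ← Real.exp_add]
    congr 2
    push_cast
    ring
  rw [Finset.sum_congr rfl fun s _ => hsplit s, ← Finset.mul_sum]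
  refine (mul_le_mul_of_nonneg_left (I.sum_prob_mul_exp_le v j) (Real.exp_pos _).le).trans_eq ?_
  rw [← Real.exp_add]
  congr 1
  ring

/-! ### Extracting a run from an adaptive policy -/

/-- A run is a sequence of jobs together with their observed sizes. It is balanced, when it
continues a run of total size `e` with truncated means `m`, if before each of its jobs the
truncated mean at the scale `2 ^ j ≤ e + 1 < 2 ^ (j + 1)` of the total size `e` observed up to
then is at most `M * 2 ^ j`. -/
def Balanced (M : ℝ) : List (V × Fin (B + 1)) → ℕ → (ℕ → ℝ) → Prop
  | [], _, _ => True
  | (v, s) :: L, e, m => m (Nat.log 2 (e + 1)) ≤ M * 2 ^ Nat.log 2 (e + 1)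
      ∧ Balanced M L (e + s) fun j => m j + I.truncMean v j

/-- The total expected reward of the jobs of a run from position `x`, time `t` and total size
`e` on, where each job is started when the run with the recorded sizes reaches it. The reward
of a job started at total size `e` is weighted by `f j`, where `2 ^ j` is the scale of `e`. -/
noncomputable def runValue (f : ℕ → ℝ) : List (V × Fin (B + 1)) → V → ℕ → ℕ → ℝ
  | [], _, _, _ => 0
  | (v, s) :: L, x, t, e => I.jobValue v (t + I.dist x v) * f (Nat.log 2 (e + 1))
      + runValue f L v (t + I.dist x v + (s : ℕ)) (e + (s : ℕ))

theorem exists_sum_prob_mul_le (v : V) (g : Fin (B + 1) → ℝ) :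
    ∃ s, ∑ s', I.prob v s' * g s' ≤ g s := by
  obtain ⟨s, hs⟩ := Finite.exists_max g
  refine ⟨s, (Finset.sum_le_sum fun s' _ =>
    mul_le_mul_of_nonneg_left (hs s') (I.prob_nonneg v s')).trans_eq ?_⟩
  rw [← Finset.sum_mul, I.sum_prob, one_mul]

/-- Some balanced root-leaf run of a decision tree is worth as much as the tree, up to the
potential times a bound `A` on all policies. The tree is cut where a run stops being balanced:
there the potential is at least `1`, while the rest of the tree is worth at most `A`. -/
theorem exists_balanced_run {A M : ℝ} (hA : ∀ T : DecisionTree V B, T.VisitsOnce ∅ →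
    I.treeValue T I.root 0 ≤ A) (T : DecisionTree V B) (S : Set V) (hT : T.VisitsOnce S)
    (x : V) (t e : ℕ) (m : ℕ → ℝ) (ht : I.dist I.root x ≤ t) (he : e ≤ t) :
    ∃ L : List (V × Fin (B + 1)), (L.map Prod.fst).Nodup ∧ (∀ v ∈ L.map Prod.fst, v ∉ S) ∧
      I.Balanced M L e m ∧
      I.treeValue T x t ≤ A * potential B M m e + I.runValue (fun _ => 1) L x t e := by
  have hA0 : 0 ≤ A := hA .leaf trivial
  induction T generalizing S x t e m with
  | leaf =>
    refine ⟨[], by simp, by simp, trivial, ?_⟩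
    simpa [treeValue, runValue] using mul_nonneg hA0 (potential_nonneg B M m e)
  | node v next ih =>
    by_cases htB : B < t
    · refine ⟨[], by simp, by simp, trivial, ?_⟩
      rw [I.treeValue_eq_zero _ htB]
      simpa [runValue] using mul_nonneg hA0 (potential_nonneg B M m e)
    by_cases hm : m (Nat.log 2 (e + 1)) ≤ M * 2 ^ Nat.log 2 (e + 1)
    · have hdist : ∀ s : Fin (B + 1), I.dist I.root v ≤ t + I.dist x v + (s : ℕ) := fun s => by
        have := I.dist_triangle I.root x v
        omega
      choose L hnd hdisj hbal hle using fun s : Fin (B + 1) =>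
        ih s (insert v S) (hT.2 s) v (t + I.dist x v + s) (e + s)
          (fun j => m j + I.truncMean v j) (hdist s) (by omega)
      obtain ⟨s, hs⟩ := I.exists_sum_prob_mul_le v fun s =>
        I.runValue (fun _ => 1) (L s) v (t + I.dist x v + s) (e + s)
      refine ⟨(v, s) :: L s, ?_, ?_, ⟨hm, hbal s⟩, ?_⟩
      · rw [List.map_cons, List.nodup_cons]
        exact ⟨fun h => hdisj s v h (Set.mem_insert v S), hnd s⟩
      · intro w hw
        rw [List.map_cons, List.mem_cons] at hw
        rcases hw with rfl | hw
        · exact hT.1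
        · exact fun h => hdisj s w hw (Set.mem_insert_of_mem v h)
      · have hpot := mul_le_mul_of_nonneg_left (I.sum_prob_mul_potential_le v M m e) hA0
        have hsum := Finset.sum_le_sum fun s (_ : s ∈ Finset.univ) =>
          mul_le_mul_of_nonneg_left (hle s) (I.prob_nonneg v s)
        simp only [mul_add, Finset.sum_add_distrib, mul_left_comm _ A, ← Finset.mul_sum] at hsum
        simp only [treeValue, runValue, mul_one]
        linarith
    · refine ⟨[], by simp, by simp, trivial, ?_⟩
      have h1 : 1 ≤ potential B M m e := one_le_potential (by omega) (not_le.1 hm)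
      have h2 : I.treeValue (.node v next) x t ≤ A := by
        refine le_trans (I.treeValue_mono _ fun w => ?_)
          (hA _ (hT.anti (Set.empty_subset S)))
        have := I.dist_triangle I.root x w
        omega
      simp only [runValue, add_zero]
      nlinarith

/-! ### Thinning a run -/

theorem runValue_mono {f g : ℕ → ℝ} (h : ∀ j, f j ≤ g j) (L : List (V × Fin (B + 1))) (x : V)
    (t e : ℕ) : I.runValue f L x t e ≤ I.runValue g L x t e := by
  induction L generalizing x t e with
  | nil => exact le_rfl
  | cons a L ih =>
    exact add_le_add (mul_le_mul_of_nonneg_left (h _) (I.jobValue_nonneg _ _)) (ih _ _ _)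

theorem runValue_add (f g : ℕ → ℝ) (L : List (V × Fin (B + 1))) (x : V) (t e : ℕ) :
    I.runValue (fun j => f j + g j) L x t e = I.runValue f L x t e + I.runValue g L x t e := by
  induction L generalizing x t e with
  | nil => simp [runValue]
  | cons a L ih => simp only [runValue, ih]; ring

theorem runValue_mul (c : ℝ) (f : ℕ → ℝ) (L : List (V × Fin (B + 1))) (x : V) (t e : ℕ) :
    I.runValue (fun j => c * f j) L x t e = c * I.runValue f L x t e := by
  induction L generalizing x t e with
  | nil => simp [runValue]
  | cons a L ih => simp only [runValue, ih]; ring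

theorem runValue_sum {ι : Type*} (s : Finset ι) (f : ι → ℕ → ℝ) (L : List (V × Fin (B + 1)))
    (x : V) (t e : ℕ) :
    I.runValue (fun j => ∑ i ∈ s, f i j) L x t e = ∑ i ∈ s, I.runValue (f i) L x t e := by
  induction L generalizing x t e with
  | nil => simp [runValue]
  | cons a L ih => simp only [runValue, ih, Finset.mul_sum, Finset.sum_add_distrib]

/-- A lower bound, by Markov's inequality, for the probability that a thinned run is on time for
the jobs started at scale `2 ^ j`: so far the thinned run has total size `e` and the full
run has truncated means `m`, at most `2 ^ j / (2 * p)` in the end. -/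
noncomputable def onTime (p : ℝ) (m : ℕ → ℝ) (e j : ℕ) : ℝ :=
  1 / 2 - (min (e : ℝ) (2 ^ j) - p * m j) / 2 ^ j

/-- The bound `onTime` is a submartingale under thinning: the next job `v` of the run raises the
truncated mean of the full run by `truncMean v j` and, being kept with probability `p`, the mean
of the truncated size of the thinned run by at most `p * truncMean v j`. -/
theorem onTime_le {p : ℝ} (hp0 : 0 ≤ p) (m : ℕ → ℝ) (e : ℕ) (v : V) (j : ℕ) :
    onTime p m e j ≤ (1 - p) * onTime p (fun j => m j + I.truncMean v j) e j
      + p * ∑ s : Fin (B + 1),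
          I.prob v s * onTime p (fun j => m j + I.truncMean v j) (e + s) j := by
  have h2 : (0 : ℝ) < 2 ^ j := by positivity
  have hs : ∀ s : Fin (B + 1), onTime p (fun j => m j + I.truncMean v j) e j
      - min ((s : ℕ) : ℝ) (2 ^ j) / 2 ^ j
        ≤ onTime p (fun j => m j + I.truncMean v j) (e + s) j := fun s => by
    have hmin : min ((e + (s : ℕ) : ℕ) : ℝ) (2 ^ j)
        ≤ min (e : ℝ) (2 ^ j) + min ((s : ℕ) : ℝ) (2 ^ j) := by
      have he : (0 : ℝ) ≤ e := e.cast_nonneg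
      have hs : (0 : ℝ) ≤ (s : ℕ) := Nat.cast_nonneg _
      push_cast
      rcases le_total (e : ℝ) (2 ^ j) with h | h <;>
        rcases le_total ((s : ℕ) : ℝ) (2 ^ j) with h' | h' <;>
        simp only [min_eq_left h, min_eq_right h, min_eq_left h', min_eq_right h'] <;>
        first
        | exact min_le_left _ _
        | exact (min_le_right _ _).trans (by linarith)
    have := div_le_div_of_nonneg_right hmin h2.le
    unfold onTime
    rw [sub_div, sub_div]
    rw [add_div] at this
    linarith
  have hsum := Finset.sum_le_sum fun s (_ : s ∈ Finset.univ) =>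
    mul_le_mul_of_nonneg_left (hs s) (I.prob_nonneg v s)
  simp only [mul_sub, Finset.sum_sub_distrib, ← Finset.sum_mul, I.sum_prob, one_mul,
    mul_div_assoc', ← Finset.sum_div] at hsum
  have hsum' := mul_le_mul_of_nonneg_left hsum hp0
  rw [mul_sub] at hsum'
  have hstep : onTime p m e j
      = onTime p (fun j => m j + I.truncMean v j) e j - p * (I.truncMean v j / 2 ^ j) := by
    unfold onTime
    field_simp
    ring
  unfold truncMean at hstep ⊢
  unfold truncMean at hsum'
  linarith

/-- Thinning with probability `p = 1 / (2 * M)` a run with bound `M` yields in the mean at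
least the fraction `p` of the value of the run, discounted by the chance of being late. Here
`x`, `a`, `e` are the position, travel time and total size of the full run, and `y`, `b`, `e'`
those of the thinned run, which by the triangle inequality never travels more. -/
theorem runValue_le_thinnedMean {p M : ℝ} (hp0 : 0 ≤ p) (hp1 : p ≤ 1) (hpM : p * M = 1 / 2)
    (L : List (V × Fin (B + 1))) (x y : V) (a b e e' : ℕ) (m : ℕ → ℝ)
    (hL : I.Balanced M L e m) (hab : ∀ w, b + I.dist y w ≤ a + I.dist x w) :
    p * I.runValue (onTime p m e') L x (a + e) e
      ≤ thinnedMean p (L.map Prod.fst) fun Q => I.treeValue (.ofList Q) y (b + e') := by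
  induction L generalizing x y a b e e' m with
  | nil => simp [runValue, thinnedMean, DecisionTree.ofList, treeValue]
  | cons q L ih =>
    obtain ⟨v, s₀⟩ := q
    obtain ⟨hm, hL⟩ := hL
    set m' : ℕ → ℝ := fun j => m j + I.truncMean v j with hm'
    have htime : a + e + I.dist x v + (s₀ : ℕ) = a + I.dist x v + (e + s₀) := by omega
    have hskip := ih v y (a + I.dist x v) b (e + s₀) e' m' hL fun w =>
      (hab w).trans (by have := I.dist_triangle x v w; omega)
    have htake := fun s : Fin (B + 1) =>
      ih v v (a + I.dist x v) (b + I.dist y v) (e + s₀) (e' + s) m' hL fun w => by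
        have := hab v
        omega
    have htail : I.runValue (onTime p m e') L v (a + e + I.dist x v + s₀) (e + s₀)
        ≤ (1 - p) * I.runValue (onTime p m' e') L v (a + e + I.dist x v + s₀) (e + s₀)
          + p * ∑ s : Fin (B + 1), I.prob v s
            * I.runValue (onTime p m' (e' + s)) L v (a + e + I.dist x v + s₀) (e + s₀) := by
      refine (I.runValue_mono (I.onTime_le hp0 m e' v) L _ _ _).trans_eq ?_
      rw [runValue_add, runValue_mul, runValue_mul, runValue_sum]
      simp only [runValue_mul, hm']
    have hhead : I.jobValue v (a + e + I.dist x v) * onTime p m e' (Nat.log 2 (e + 1))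
        ≤ I.jobValue v (b + e' + I.dist y v) := by
      set j := Nat.log 2 (e + 1) with hj
      have h2 : (0 : ℝ) < 2 ^ j := by positivity
      have hon : onTime p m e' j ≤ 1 - min (e' : ℝ) (2 ^ j) / 2 ^ j := by
        have : p * m j / 2 ^ j ≤ 1 / 2 := by
          rw [div_le_iff₀ h2, ← hpM, mul_assoc]
          exact mul_le_mul_of_nonneg_left hm hp0
        unfold onTime
        rw [sub_div]
        linarith
      rcases lt_or_ge e' (2 ^ j) with h | h
      · -- Sizes are integers, so a thinned run of size below the scale of `e` is not late.
        have hle : 2 ^ j ≤ e + 1 := Nat.pow_log_le_self 2 (by omega)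
        have hone : onTime p m e' j ≤ 1 := hon.trans (sub_le_self _ (by positivity))
        refine (mul_le_of_le_one_right (I.jobValue_nonneg _ _) hone).trans
          (I.jobValue_anti v ?_)
        have := hab v
        omega
      · have hmin : min (e' : ℝ) (2 ^ j) = 2 ^ j := min_eq_right (by exact_mod_cast h)
        rw [hmin, div_self h2.ne', sub_self] at hon
        exact (mul_nonpos_of_nonneg_of_nonpos (I.jobValue_nonneg _ _) hon).trans
          (I.jobValue_nonneg _ _)
    have hthin : thinnedMean p (L.map Prod.fst)
          (fun Q => I.treeValue (.ofList (v :: Q)) y (b + e'))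
        = I.jobValue v (b + e' + I.dist y v) + ∑ s : Fin (B + 1), I.prob v s
          * thinnedMean p (L.map Prod.fst) fun Q =>
              I.treeValue (.ofList Q) v (b + I.dist y v + (e' + s)) := by
      have ht : ∀ s : Fin (B + 1), b + e' + I.dist y v + (s : ℕ)
          = b + I.dist y v + (e' + s) := fun s => by omega
      simp only [DecisionTree.ofList, treeValue, ht]
      exact thinnedMean_affine p _ _ _
        (fun (s : Fin (B + 1)) Q => I.treeValue (.ofList Q) v (b + I.dist y v + (e' + (s : ℕ)))) _
    have hsum := Finset.sum_le_sum fun s (_ : s ∈ Finset.univ) =>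
      mul_le_mul_of_nonneg_left (htake s) (I.prob_nonneg v s)
    simp only [mul_left_comm _ p, ← Finset.mul_sum] at hsum
    simp only [List.map_cons, thinnedMean, runValue, hthin]
    rw [htime] at htail ⊢
    have h1 := mul_le_mul_of_nonneg_left hskip (sub_nonneg.2 hp1)
    have h2 := mul_le_mul_of_nonneg_left hsum hp0
    have h3 := mul_le_mul_of_nonneg_left (add_le_add hhead htail) hp0
    linarith

/-! ### The adaptivity gap -/

/-- The two steps combined. With `M = 4 + 2 * log (2 * J)`, where `J` is the number of scales,
the potential is initially `1 / 2`; thinning with probability `1 / (2 * M)` then recovers the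
fraction `1 / (4 * M)` of the value of the run. -/
theorem treeValue_le {A M N : ℝ}
    (hA : ∀ T : DecisionTree V B, T.VisitsOnce ∅ → I.treeValue T I.root 0 ≤ A)
    (hN : ∀ P : List V, P.Nodup → I.treeValue (.ofList P) I.root 0 ≤ N)
    (hM : M = 4 + 2 * Real.log (2 * (Nat.log 2 (B + 1) + 1 : ℕ)))
    {T : DecisionTree V B} (hT : T.VisitsOnce ∅) :
    I.treeValue T I.root 0 ≤ A / 2 + 4 * M * N := by
  set J := Nat.log 2 (B + 1) + 1 with hJ
  have hJ1 : (1 : ℝ) ≤ J := by exact_mod_cast Nat.le_add_left 1 _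
  have hM4 : 4 ≤ M := by
    have := Real.log_nonneg (x := 2 * J) (by linarith)
    linarith
  have hA0 : 0 ≤ A := hA .leaf trivial
  obtain ⟨L, hnd, -, hbal, hle⟩ := I.exists_balanced_run hA (M := M) T ∅ hT I.root 0 0
    (fun _ => 0) (by rw [I.dist_self]) le_rfl
  have hpot : potential B M (fun _ => 0) 0 = 1 / 2 := by
    have hexp : 2 - M / 2 = -Real.log (2 * J) := by rw [hM]; ring
    simp only [potential, ← hJ, hexp, Nat.cast_zero, neg_zero, zero_div, zero_add,
      Finset.sum_const, Finset.card_range, nsmul_eq_mul]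
    rw [Real.exp_neg, Real.exp_log (by linarith)]
    field_simp
  have hp0 : 0 ≤ 1 / (2 * M) := by positivity
  have hp1 : 1 / (2 * M) ≤ 1 := by
    rw [div_le_one (by linarith)]
    linarith
  have hthin := I.runValue_le_thinnedMean hp0 hp1 (M := M) (by field_simp) L I.root I.root
    0 0 0 0 (fun _ => 0) hbal fun _ => le_rfl
  obtain ⟨Q, hQ, hQle⟩ := exists_sublist_thinnedMean_le hp0 hp1 (L.map Prod.fst)
    fun Q => I.treeValue (.ofList Q) I.root (0 + 0)
  have hhalf : onTime (1 / (2 * M)) (fun _ => 0) 0 = fun _ => (1 / 2 : ℝ) * 1 := by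
    funext j
    simp [onTime]
  rw [hhalf, runValue_mul] at hthin
  have hfin := (hthin.trans hQle).trans (hN Q (hnd.sublist hQ))
  have hval : I.runValue (fun _ => 1) L I.root 0 0 ≤ 4 * M * N := by
    have h := mul_le_mul_of_nonneg_left hfin (show 0 ≤ 4 * M by linarith)
    refine le_trans (le_of_eq ?_) h
    rw [add_zero]
    field_simp
    ring
  rw [hpot] at hle
  linarith

section Gap

variable [Fintype V]

theorem treeValue_le_optAdaptive {T : DecisionTree V B} (hT : T.VisitsOnce ∅) :
    I.treeValue T I.root 0 ≤ I.optAdaptive.toReal := by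
  rw [← ENNReal.ofReal_le_iff_le_toReal I.optAdaptive_ne_top,
    ← I.adaptiveValue_eq ⟨T, hT⟩]
  exact le_iSup I.adaptiveValue _

theorem treeValue_ofList_le_optNonAdaptive (hN : I.optNonAdaptive ≠ ⊤) {P : List V}
    (hP : P.Nodup) : I.treeValue (.ofList P) I.root 0 ≤ I.optNonAdaptive.toReal := by
  rw [← ENNReal.ofReal_le_iff_le_toReal hN, ← I.nonAdaptiveValue_eq ⟨P, hP⟩]
  exact le_iSup I.nonAdaptiveValue _

theorem optAdaptive_le :
    I.optAdaptive ≤ ENNReal.ofReal (32 + 16 * Real.log (2 * (Nat.log 2 (B + 1) + 1 : ℕ)))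
      * I.optNonAdaptive := by
  set M := 4 + 2 * Real.log (2 * (Nat.log 2 (B + 1) + 1 : ℕ)) with hM
  have hlog : 0 ≤ Real.log (2 * (Nat.log 2 (B + 1) + 1 : ℕ)) := by
    refine Real.log_nonneg ?_
    have : (1 : ℝ) ≤ (Nat.log 2 (B + 1) + 1 : ℕ) := by exact_mod_cast Nat.le_add_left 1 _
    linarith
  rw [show 32 + 16 * Real.log (2 * (Nat.log 2 (B + 1) + 1 : ℕ)) = 8 * M by rw [hM]; ring]
  by_cases hN : I.optNonAdaptive = ⊤
  · rw [hN, ENNReal.mul_top (ENNReal.ofReal_pos.2 (by linarith)).ne']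
    exact le_top
  set N := I.optNonAdaptive.toReal with hNdef
  have hle : I.optAdaptive
      ≤ ENNReal.ofReal (I.optAdaptive.toReal / 2 + 4 * M * N) := iSup_le fun T => by
    rw [I.adaptiveValue_eq]
    exact ENNReal.ofReal_le_ofReal (I.treeValue_le (fun _ => I.treeValue_le_optAdaptive)
      (fun _ => I.treeValue_ofList_le_optNonAdaptive hN) hM T.2)
  have hreal := ENNReal.toReal_le_of_le_ofReal (add_nonneg (by positivity)
    (mul_nonneg (by linarith) ENNReal.toReal_nonneg)) hle
  rw [← ENNReal.ofReal_toReal hN, ← ENNReal.ofReal_mul (by linarith),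
    ← ENNReal.ofReal_toReal I.optAdaptive_ne_top]
  exact ENNReal.ofReal_le_ofReal (by linarith)

end Gap

end CorrOrient

theorem exists_log_log_bound : ∃ C : ℝ, 0 < C ∧ ∀ B : ℕ, 3 ≤ B →
    32 + 16 * Real.log (2 * (Nat.log 2 (B + 1) + 1 : ℕ)) ≤ C * Real.log (Real.log (B : ℝ)) := by
  have hlog3 : 1 < Real.log 3 := by
    rw [Real.lt_log_iff_exp_lt (by norm_num)]
    exact Real.exp_one_lt_three
  have hc : 0 < Real.log (Real.log 3) := Real.log_pos hlog3
  refine ⟨16 + 80 / Real.log (Real.log 3), by positivity, fun B hB => ?_⟩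
  have hB3 : (3 : ℝ) ≤ B := by exact_mod_cast hB
  have hlogB : Real.log 3 ≤ Real.log B := Real.log_le_log (by norm_num) hB3
  have hmono : Real.log (Real.log 3) ≤ Real.log (Real.log B) :=
    Real.log_le_log (by linarith) hlogB
  have hpow : (2 : ℝ) ^ Nat.log 2 (B + 1) ≤ (B : ℝ) ^ 2 := by
    have h : ((2 ^ Nat.log 2 (B + 1) : ℕ) : ℝ) ≤ ((B + 1 : ℕ) : ℝ) :=
      Nat.cast_le.2 (Nat.pow_log_le_self 2 (by omega))
    push_cast at h
    nlinarith
  have hnat : (Nat.log 2 (B + 1) : ℝ) ≤ 4 * Real.log B := by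
    have h := Real.log_le_log (by positivity) hpow
    rw [Real.log_pow, Real.log_pow] at h
    have h2 := Real.log_two_gt_d9
    have : (0 : ℝ) ≤ Nat.log 2 (B + 1) := Nat.cast_nonneg _
    push_cast at h
    nlinarith
  have hten : Real.log 10 ≤ 3 := by
    rw [Real.log_le_iff_le_exp (by norm_num)]
    have h := Real.exp_one_gt_d9
    rw [show (3 : ℝ) = (3 : ℕ) * 1 by norm_num, Real.exp_nat_mul]
    refine le_trans ?_ (pow_le_pow_left₀ (by norm_num) h.le 3)
    norm_num
  have hJ : Real.log (2 * (Nat.log 2 (B + 1) + 1 : ℕ)) ≤ 3 + Real.log (Real.log B) := by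
    have h10 : (2 * (Nat.log 2 (B + 1) + 1 : ℕ) : ℝ) ≤ 10 * Real.log B := by
      push_cast
      linarith
    refine (Real.log_le_log (by positivity) h10).trans ?_
    rw [Real.log_mul (by norm_num) (by linarith)]
    linarith
  have hconst : 80 ≤ 80 / Real.log (Real.log 3) * Real.log (Real.log B) := by
    rw [div_mul_eq_mul_div, le_div_iff₀ hc]
    linarith
  linarith

theorem theorem2 :
    ∃ C : ℝ, 0 < C ∧ ∀ B : ℕ, 3 ≤ B →
      adaptivityGap.{u} B ≤ ENNReal.ofReal (C * Real.log (Real.log (B : ℝ))) := by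
  obtain ⟨C, hC, h⟩ := exists_log_log_bound
  refine ⟨C, hC, fun B hB => iSup_le fun V => iSup_le fun _ => iSup_le fun I => ?_⟩
  refine ENNReal.div_le_of_le_mul (I.optAdaptive_le.trans ?_)
  gcongr
  exact h B hB
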